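/- An access point with $N\ge 2$ antennas, a single-antenna user and a single-antenna relay use the channels $\mathbf h_1,\mathbf h_2\in\mathbb C^N$ (user to access point, relay to access point) and $h_3\in\mathbb C$ (user to relay). All $2N+1$ entries of $\mathbf h_1,\mathbf h_2,h_3$ are independent $\mathcal{CN}(0,1)$ random variables. Let $\eta>0$, $0<\tau<1$, $P_s,N_0>0$, $d_1,d_2,d_3>0$, $\alpha\in\mathbb R$ and $\rho=P_s/N_0$. For an energy beamforming vector $\mathbf w\in\mathbb C^N$ the end-to-end signal to noise ratio is $$\gamma_{\sf s}(\mathbf w)=\frac{2\eta\tau\rho|\mathbf h_1^T\mathbf w|^2\|\mathbf h_1\|^2}{(1-\tau)d_1^{2\alpha}}+\frac{\dfrac{4\eta^2\tau^2\rho^2|\mathbf h_1^T\mathbf w|^2|\mathbf h_2^T\mathbf w|^2|h_3|^2\|\mathbf h_2\|^2}{(1-\tau)^2d_1^\alpha d_2^{2\alpha}d_3^\alpha}}{\dfrac{2\eta\tau\rho|\mathbf h_1^T\mathbf w|^2|h_3|^2}{(1-\tau)d_1^\alpha d_3^\alpha}+\dfrac{2\eta\tau\rho|\mathbf h_2^T\mathbf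 w|^2\|\mathbf h_2\|^2}{(1-\tau)d_2^{2\alpha}}+1},$$ and the throughput is $R(\mathbf w)=\frac{1-\tau}{2}\log_2(1+\gamma_{\sf s}(\mathbf w))$. Put $a_1=\frac{2\eta\tau\rho}{(1-\tau)d_1^{2\alpha}}$, $b_1=\frac{2\eta\tau\rho}{(1-\tau)d_1^\alpha d_3^\alpha}$, $c_1=\frac{2\eta\tau\rho}{(1-\tau)d_2^{2\alpha}}$. Let $\mathbf w=\mathbf h_1^*/\|\mathbf h_1\|$, where $\mathbf h_1^*$ is the entrywise conjugate. Then $R(\mathbf w)$ is integrable and the average throughput $C=\mathbb E[R(\mathbf w)]$ satisfies $C\ge C_{\sf low}$, where $$C_{\sf low}=\frac{1-\tau}{2}\log_2\left(1+e^{m_1}+e^{m_2+m_3-\ln(1+m_4+m_5)}\right),$$ with $\psi$ the digamma function and $$m_1=\ln a_1+2\psi(1)+2\sum_{m=1}^{N-1}\frac1m,\qquad m_2=\ln b_1+2\psi(1)+\sum_{m=1}^{N-1}\frac1m,$$ $$m_3=\ln c_1+2\psi(1)+2\sum_{m=1}^{N-1}\frac1m-(N-1)\sum_{i=0}^{N-2}\binom{N-2}{i}\frac{(-1)^i}{(i+1)^2},\qquad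 m_4=b_1N,$$ $$m_5=4c_1(N-1)\sum_{m=0}^{N-1}\frac1{m!}\sum_{i=0}^{N-2}\binom{N-2}{i}(-1)^i\frac{\Gamma(m+2)}{2i+4}.$$ If $N\ge 3$, then $C\ge C_{\sf low}$ holds also with $m_4$ replaced by $b_1N(N-1)/2$. -/

import Mathlib

open MeasureTheory ProbabilityTheory
open scoped ENNReal NNReal BigOperators

namespace WirelessPowered

/-- The circularly symmetric complex Gaussian law `CN(0,1)`: the real and the imaginary part are
independent real Gaussian variables with mean `0` and variance `1/2`. -/
noncomputable def complexGaussian : Measure ℂ :=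
  ((gaussianReal 0 (1 / 2)).prod (gaussianReal 0 (1 / 2))).map Complex.measurableEquivRealProd.symm

/-- The deterministic parameters of the system. -/
structure Params where
  /-- RF energy conversion efficiency `η` -/
  eta : ℝ
  /-- time split parameter `τ` -/
  tau : ℝ
  /-- transmit power `P_s` of the access point -/
  Ps : ℝ
  /-- noise power `N_0` -/
  N0 : ℝ
  /-- path loss exponent `α` -/
  alpha : ℝ
  /-- distance from the access point to the user -/
  d1 : ℝ
  /-- distance from the access point to the relay -/
  d2 : ℝ
  /-- distance from the user to the relay -/
  d3 : ℝ

/-- The admissible range of the parameters. -/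
structure Params.Admissible (p : Params) : Prop where
  eta_pos : 0 < p.eta
  tau_pos : 0 < p.tau
  tau_lt_one : p.tau < 1
  Ps_pos : 0 < p.Ps
  N0_pos : 0 < p.N0
  d1_pos : 0 < p.d1
  d2_pos : 0 < p.d2
  d3_pos : 0 < p.d3

/-- `ρ = P_s / N_0`. -/
noncomputable def Params.rho (p : Params) : ℝ := p.Ps / p.N0

/-- The bilinear (unconjugated) product `hᵀ w`. -/
noncomputable def tdot {N : ℕ} (h w : EuclideanSpace ℂ (Fin N)) : ℂ := ∑ i, h i * w i

/-- The end-to-end signal to noise ratio `γ_s` at the access point, for the energy beamforming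
vector `w` and the channels `h1` (user to access point), `h2` (relay to access point) and `h3`
(user to relay). -/
noncomputable def snr {N : ℕ} (p : Params) (w h1 h2 : EuclideanSpace ℂ (Fin N)) (h3 : ℂ) : ℝ :=
  2 * p.eta * p.tau * p.rho * ‖tdot h1 w‖ ^ 2 * ‖h1‖ ^ 2
      / ((1 - p.tau) * p.d1 ^ (2 * p.alpha))
    + (4 * p.eta ^ 2 * p.tau ^ 2 * p.rho ^ 2
          * ‖tdot h1 w‖ ^ 2 * ‖tdot h2 w‖ ^ 2 * ‖h3‖ ^ 2 * ‖h2‖ ^ 2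
        / ((1 - p.tau) ^ 2 * p.d1 ^ p.alpha * p.d2 ^ (2 * p.alpha) * p.d3 ^ p.alpha))
      / (2 * p.eta * p.tau * p.rho * ‖tdot h1 w‖ ^ 2 * ‖h3‖ ^ 2
            / ((1 - p.tau) * p.d1 ^ p.alpha * p.d3 ^ p.alpha)
          + 2 * p.eta * p.tau * p.rho * ‖tdot h2 w‖ ^ 2 * ‖h2‖ ^ 2
            / ((1 - p.tau) * p.d2 ^ (2 * p.alpha))
          + 1)

/-- The achievable throughput `R = (1 - τ)/2 · log₂ (1 + γ_s)`. -/
noncomputable def throughput {N : ℕ} (p : Params) (w h1 h2 : EuclideanSpace ℂ (Fin N)) (h3 : ℂ) :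
    ℝ :=
  (1 - p.tau) / 2 * Real.logb 2 (1 + snr p w h1 h2 h3)

/-- The energy beamforming vector `w = h* / ‖h‖` (entrywise conjugate). -/
noncomputable def mrtBeam {N : ℕ} (h : EuclideanSpace ℂ (Fin N)) : EuclideanSpace ℂ (Fin N) :=
  WithLp.toLp 2 fun i => starRingEnd ℂ (h i) / (‖h‖ : ℂ)

/-- Rayleigh fading: all entries of `h1` and `h2`, together with `h3`, are mutually independent
`CN(0,1)` random variables. -/
structure IsRayleigh {Ω : Type*} [MeasurableSpace Ω] (P : Measure Ω) {N : ℕ}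
    (h1 h2 : Ω → EuclideanSpace ℂ (Fin N)) (h3 : Ω → ℂ) : Prop where
  law_h1 : ∀ i, HasLaw (fun ω => h1 ω i) complexGaussian P
  law_h2 : ∀ i, HasLaw (fun ω => h2 ω i) complexGaussian P
  law_h3 : HasLaw h3 complexGaussian P
  indep : iIndepFun (Sum.elim (fun (i : Fin N) (ω : Ω) => h1 ω i)
    (Sum.elim (fun (i : Fin N) (ω : Ω) => h2 ω i) (fun (_ : Unit) (ω : Ω) => h3 ω))) P

/-- `a₁ = 2ητρ / ((1-τ) d₁^{2α})`. -/
noncomputable def Params.a1 (p : Params) : ℝ :=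
  2 * p.eta * p.tau * p.rho / ((1 - p.tau) * p.d1 ^ (2 * p.alpha))

/-- `b₁ = 2ητρ / ((1-τ) d₁^α d₃^α)`. -/
noncomputable def Params.b1 (p : Params) : ℝ :=
  2 * p.eta * p.tau * p.rho / ((1 - p.tau) * p.d1 ^ p.alpha * p.d3 ^ p.alpha)

/-- `c₁ = 2ητρ / ((1-τ) d₂^{2α})`. -/
noncomputable def Params.c1 (p : Params) : ℝ :=
  2 * p.eta * p.tau * p.rho / ((1 - p.tau) * p.d2 ^ (2 * p.alpha))

/-- `ψ(1)`, the value of the digamma function at `1`. -/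
noncomputable def psiOne : ℝ := (Complex.digamma 1).re

noncomputable def m1 (p : Params) (N : ℕ) : ℝ :=
  Real.log p.a1 + 2 * psiOne + 2 * ∑ m ∈ Finset.Icc 1 (N - 1), 1 / (m : ℝ)

noncomputable def m2 (p : Params) (N : ℕ) : ℝ :=
  Real.log p.b1 + 2 * psiOne + ∑ m ∈ Finset.Icc 1 (N - 1), 1 / (m : ℝ)

noncomputable def m3 (p : Params) (N : ℕ) : ℝ :=
  Real.log p.c1 + 2 * psiOne + 2 * ∑ m ∈ Finset.Icc 1 (N - 1), 1 / (m : ℝ)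
    - ((N : ℝ) - 1) * ∑ i ∈ Finset.Icc 0 (N - 2),
        (Nat.choose (N - 2) i : ℝ) * (-1) ^ i * (1 / ((i : ℝ) + 1) ^ 2)

/-- The mean of the user-to-relay gain, `b₁ N`. -/
noncomputable def m4 (p : Params) (N : ℕ) : ℝ := p.b1 * N

/-- The alternative constant `b₁ N (N - 1) / 2`. -/
noncomputable def m4' (p : Params) (N : ℕ) : ℝ := p.b1 * N * ((N : ℝ) - 1) / 2

noncomputable def m5 (p : Params) (N : ℕ) : ℝ :=
  4 * p.c1 * ((N : ℝ) - 1) * ∑ m ∈ Finset.Icc 0 (N - 1), 1 / (Nat.factorial m : ℝ) *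
    ∑ i ∈ Finset.Icc 0 (N - 2), (Nat.choose (N - 2) i : ℝ) * (-1) ^ i *
      (Real.Gamma ((m : ℝ) + 2) / (2 * (i : ℝ) + 4))

/-- `(1-τ)/2 · log₂ (1 + e^{m₁} + e^{m₂ + m₃ - ln (1 + μ + m₅)})`, where `μ` stands in the place of
the fourth constant. -/
noncomputable def lowerBound (p : Params) (N : ℕ) (μ : ℝ) : ℝ :=
  (1 - p.tau) / 2 * Real.logb 2 (1 + Real.exp (m1 p N)
    + Real.exp (m2 p N + m3 p N - Real.log (1 + μ + m5 p N)))

end WirelessPowered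

namespace WirelessPowered

/-! For `w = h₁* / ‖h₁‖` one has `|h₁ᵀw|² = ‖h₁‖²`, so the SNR is `a₁X² + BC/(B + C + 1)` with `B =
b₁XZ`, `C = c₁VY`, `X = ‖h₁‖²`, `Y = ‖h₂‖²`, `Z = |h₃|²`, `V = |h₂ᵀw|²`. Here `X, Y` are Gamma(N, 1)
and `Z, V` are Exp(1); for `V`, a unit beam determined by `h₁` leaves `h₂ᵀw` standard complex
Gaussian by independence.

The function `(u, v) ↦ log(1 + e^u + e^v)` is convex and increasing in `v`. Jensen with `u =
log(a₁X²)` and `v = log(BC) - log(1 + B + C)`, followed by Jensen for the concave logarithm, `E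
log(1 + B + C) ≤ log(1 + E B + E C)`, gives the bound. Only marginal logarithmic means and the means
of `XZ` and `VY` enter, so the dependence between `V` and `Y` does no harm: `E log` of a Gamma(n, 1)
variable is `ψ(1) + H_{n-1}`, `E[XZ] = N` by independence, and `E[VY] = N + 1` by fourth Gaussian
moments. These values match the stated constants because the alternating binomial sums collapse to
`m₃ = ln c₁ + 2ψ(1) + H_{N-1}` and `m₅ = c₁(N + 1)` (`m3_eq`, `m5_eq`).

The bound decreases in the fourth constant, and `b₁N ≤ b₁N(N-1)/2` once `N ≥ 3`; hence the second
version. -/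

/-! ### Gamma laws: moments, logarithmic mean, characteristic function -/

lemma integral_gammaMeasure {E : Type*} [NormedAddCommGroup E] [NormedSpace ℝ E] {a : ℝ}
    (ha : 0 < a) (f : ℝ → E) :
    ∫ x, f x ∂(gammaMeasure a 1) =
      (Real.Gamma a)⁻¹ • ∫ x in Set.Ioi 0, (Real.exp (-x) * x ^ (a - 1)) • f x := by
  rw [gammaMeasure, show gammaPDF a 1 = fun x => ENNReal.ofReal (gammaPDFReal a 1 x) from rfl,
    integral_withDensity_eq_integral_toReal_smul (by fun_prop) (by simp),
    ← integral_smul, ← integral_indicator measurableSet_Ioi, ]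
  refine integral_congr_ae ?_
  filter_upwards [Measure.ae_ne volume (0 : ℝ)] with x hx
  rw [ENNReal.toReal_ofReal (gammaPDFReal_nonneg ha one_pos x)]
  rcases lt_or_gt_of_ne hx with h | h
  · rw [gammaPDFReal, if_neg (not_le.mpr h), Set.indicator_of_notMem (by simp [h.le]), zero_smul]
  · rw [gammaPDFReal, if_pos h.le, Set.indicator_of_mem (by simpa using h), smul_smul]
    simp only [Real.one_rpow, one_mul, one_div]
    ring_nf

lemma integrable_gammaMeasure {E : Type*} [NormedAddCommGroup E] [NormedSpace ℝ E] {a : ℝ}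
    (ha : 0 < a) {f : ℝ → E}
    (hf : IntegrableOn (fun x => (Real.exp (-x) * x ^ (a - 1)) • f x) (Set.Ioi 0)) :
    Integrable f (gammaMeasure a 1) := by
  rw [gammaMeasure, show gammaPDF a 1 = fun x => ENNReal.ofReal (gammaPDFReal a 1 x) from rfl,
    integrable_withDensity_iff_integrable_smul' (by fun_prop) (by simp)]
  rw [← integrable_indicator_iff measurableSet_Ioi] at hf
  refine (hf.smul (Real.Gamma a)⁻¹).congr ?_
  filter_upwards [Measure.ae_ne volume (0 : ℝ)] with x hx
  rw [ENNReal.toReal_ofReal (gammaPDFReal_nonneg ha one_pos x), Pi.smul_apply]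
  rcases lt_or_gt_of_ne hx with h | h
  · rw [gammaPDFReal, if_neg (not_le.mpr h), Set.indicator_of_notMem (by simp [h.le]), zero_smul,
      smul_zero]
  · rw [gammaPDFReal, if_pos h.le, Set.indicator_of_mem (by simpa using h), smul_smul]
    simp only [Real.one_rpow, one_mul, one_div]
    ring_nf

lemma gammaMeasure_ae_pos (a : ℝ) : ∀ᵐ x ∂(gammaMeasure a 1), 0 < x := by
  rw [gammaMeasure, ae_withDensity_iff (by unfold gammaPDF; fun_prop)]
  filter_upwards [Measure.ae_ne volume (0 : ℝ)] with x hx h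
  by_contra hneg
  exact h (gammaPDF_of_neg (lt_of_le_of_ne (not_lt.mp hneg) hx))

lemma integrable_pow_gammaMeasure {a : ℝ} (ha : 0 < a) (k : ℕ) :
    Integrable (fun x : ℝ => x ^ k) (gammaMeasure a 1) := by
  refine integrable_gammaMeasure ha ?_
  refine (Real.GammaIntegral_convergent (s := a + k) (by positivity)).congr_fun
    (fun x (hx : 0 < x) => ?_) measurableSet_Ioi
  dsimp only
  rw [show a + k - 1 = (a - 1) + k by ring, Real.rpow_add_natCast hx.ne', smul_eq_mul]
  ring

lemma integral_pow_gammaMeasure {a : ℝ} (ha : 0 < a) (k : ℕ) :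
    ∫ x, x ^ k ∂(gammaMeasure a 1) = Real.Gamma (a + k) / Real.Gamma a := by
  rw [integral_gammaMeasure ha, Real.Gamma_eq_integral (s := a + k) (by positivity),
    div_eq_inv_mul, smul_eq_mul]
  congr 1
  refine setIntegral_congr_fun measurableSet_Ioi fun x (hx : 0 < x) => ?_
  rw [show a + k - 1 = (a - 1) + k by ring, Real.rpow_add_natCast hx.ne', smul_eq_mul]
  ring

/-- The logarithm is dominated by `x` at infinity and by a multiple of `x^(-a/2)` at zero. The
exponent `a/2` leaves a convergent Gamma integral with parameter `a/2 > 0`. -/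
lemma integrableOn_exp_neg_mul_rpow_mul_log {a : ℝ} (ha : 0 < a) :
    IntegrableOn (fun x : ℝ => Real.exp (-x) * x ^ (a - 1) * Real.log x) (Set.Ioi 0) := by
  have h1 := Real.GammaIntegral_convergent (s := a / 2) (by positivity)
  have h2 := Real.GammaIntegral_convergent (s := a + 1) (by positivity)
  refine ((h1.const_mul (2 / a)).add h2).mono' (by measurability) ?_
  refine (ae_restrict_iff' measurableSet_Ioi).mpr (ae_of_all _ fun x (hx : 0 < x) => ?_)
  have hlog : |Real.log x| ≤ 2 / a * x ^ (-(a / 2)) + x := by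
    rw [abs_le]
    have hp : 0 < x ^ (-(a / 2)) := Real.rpow_pos_of_pos hx _
    constructor
    · have := Real.log_le_sub_one_of_pos hp
      rw [Real.log_rpow hx] at this
      have h3 : 2 / a * (-(a / 2) * Real.log x) ≤ 2 / a * (x ^ (-(a / 2)) - 1) := by gcongr
      have h4 : 2 / a * (-(a / 2) * Real.log x) = - Real.log x := by field_simp
      have h5 : 0 < 2 / a := by positivity
      nlinarith
    · have := Real.log_le_sub_one_of_pos hx
      have h5 : 0 < 2 / a * x ^ (-(a / 2)) := by positivity
      linarith
  rw [norm_mul, Real.norm_eq_abs, Real.norm_eq_abs, abs_of_pos (by positivity)]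
  calc Real.exp (-x) * x ^ (a - 1) * |Real.log x|
      ≤ Real.exp (-x) * x ^ (a - 1) * (2 / a * x ^ (-(a / 2)) + x) := by gcongr
    _ = _ := by
      simp only [Pi.add_apply]
      rw [show a / 2 - 1 = (a - 1) + (-(a / 2)) by ring, Real.rpow_add hx,
        show a + 1 - 1 = (a - 1) + 1 by ring, Real.rpow_add hx, Real.rpow_one]
      ring

lemma integrable_log_gammaMeasure {a : ℝ} (ha : 0 < a) :
    Integrable Real.log (gammaMeasure a 1) :=
  integrable_gammaMeasure ha (integrableOn_exp_neg_mul_rpow_mul_log ha)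

/-- Differentiating the Gamma integral under the integral sign turns the mean into `Γ'(n+1)/Γ(n+1)`,
and `Γ'(n+1) = n!(-γ + H_n)`, while `ψ(1) = -γ`. -/
lemma integral_log_gammaMeasure (n : ℕ) :
    ∫ x, Real.log x ∂(gammaMeasure (n + 1) 1) =
      psiOne + ∑ m ∈ Finset.Icc 1 n, 1 / (m : ℝ) := by
  have hd := Complex.hasDerivAt_GammaIntegral (s := n + 1) (by simp; positivity)
  have hev : Complex.GammaIntegral =ᶠ[nhds ((n : ℂ) + 1)] Complex.Gamma := by
    have : {s : ℂ | 0 < s.re} ∈ nhds ((n : ℂ) + 1) :=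
      (isOpen_lt continuous_const Complex.continuous_re).mem_nhds (by simp; positivity)
    filter_upwards [this] with s hs using (Complex.Gamma_eq_integral hs).symm
  have heq := (hd.congr_of_eventuallyEq hev.symm).unique (Complex.hasDerivAt_Gamma_nat n)
  have hreal : ∫ t : ℝ in Set.Ioi 0, (t : ℂ) ^ ((n + 1 : ℂ) - 1) * (Real.log t * Real.exp (-t)) =
      ((∫ t in Set.Ioi 0, (Real.exp (-t) * t ^ (((n : ℝ) + 1) - 1)) • Real.log t : ℝ) : ℂ) := by
    rw [← integral_complex_ofReal]
    refine setIntegral_congr_fun measurableSet_Ioi fun x (hx : 0 < x) => ?_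
    simp
    ring
  rw [hreal] at heq
  have heq' : (∫ t in Set.Ioi 0, (Real.exp (-t) * t ^ (((n : ℝ) + 1) - 1)) • Real.log t : ℝ) =
      (n.factorial : ℝ) * (-Real.eulerMascheroniConstant + harmonic n) := by
    exact_mod_cast heq
  rw [integral_gammaMeasure (by positivity), heq', Real.Gamma_nat_eq_factorial, psiOne,
    Complex.digamma_one, harmonic_eq_sum_Icc, smul_eq_mul,
    inv_mul_cancel_left₀ (by positivity)]
  simp

lemma integrableOn_pow_mul_cexp (n : ℕ) (t : ℝ) :
    IntegrableOn (fun x : ℝ => (x : ℂ) ^ n * Complex.exp (-(1 - t * Complex.I) * x))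
      (Set.Ioi 0) := by
  refine (Real.GammaIntegral_convergent (s := n + 1) (by positivity)).mono'
    (by fun_prop) ((ae_restrict_iff' measurableSet_Ioi).mpr (ae_of_all _ fun x (hx : 0 < x) => ?_))
  rw [norm_mul, Complex.norm_exp, norm_pow, Complex.norm_real, Real.norm_of_nonneg hx.le,
    add_sub_cancel_right, Real.rpow_natCast, mul_comm]
  simp

lemma integral_pow_mul_cexp (n : ℕ) (t : ℝ) :
    ∫ x : ℝ in Set.Ioi 0, (x : ℂ) ^ n * Complex.exp (-(1 - t * Complex.I) * x) =
      n.factorial * (1 / (1 - t * Complex.I)) ^ (n + 1) := by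
  set r : ℂ := 1 - t * Complex.I with hr
  have hr0 : r ≠ 0 := fun h => by simpa [hr] using congrArg Complex.re h
  have hlim (n : ℕ) : Filter.Tendsto (fun x : ℝ => -(1 / r) * ((x : ℂ) ^ n * Complex.exp (-r * x)))
      Filter.atTop (nhds 0) := by
    rw [← mul_zero (-(1 / r))]
    refine Filter.Tendsto.const_mul _ (tendsto_zero_iff_norm_tendsto_zero.mpr ?_)
    refine (Real.tendsto_pow_mul_exp_neg_atTop_nhds_zero n).congr' ?_
    filter_upwards [Filter.eventually_ge_atTop 0] with x hx
    rw [norm_mul, Complex.norm_exp, norm_pow, Complex.norm_real, Real.norm_of_nonneg hx]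
    simp [hr]
  have hexp (x : ℝ) : HasDerivAt (fun x : ℝ => Complex.exp (-r * x))
      (Complex.exp (-r * x) * -r) x := by
    have : HasDerivAt (fun x : ℝ => -r * (x : ℂ)) (-r * 1) x :=
      (Complex.ofRealCLM.hasDerivAt).const_mul (-r)
    simpa using this.cexp
  induction n with
  | zero =>
    have hd (x : ℝ) : HasDerivAt (fun x : ℝ => -(1 / r) * ((x : ℂ) ^ 0 * Complex.exp (-r * x)))
        ((x : ℂ) ^ 0 * Complex.exp (-r * x)) x := by
      simp only [pow_zero, one_mul]
      exact ((hexp x).const_mul (-(1 / r))).congr_deriv (by field_simp)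
    rw [integral_Ioi_of_hasDerivAt_of_tendsto (hd 0).continuousAt.continuousWithinAt
      (fun x _ => hd x) (integrableOn_pow_mul_cexp 0 t) (hlim 0)]
    simp
  | succ n ih =>
    -- One integration by parts, encoded as an antiderivative that vanishes at both ends of the
    -- half-line.
    have hd (x : ℝ) :
        HasDerivAt (fun x : ℝ => -(1 / r) * ((x : ℂ) ^ (n + 1) * Complex.exp (-r * x)))
        ((x : ℂ) ^ (n + 1) * Complex.exp (-r * x) -
          (n + 1) / r * ((x : ℂ) ^ n * Complex.exp (-r * x))) x := by
      have hp : HasDerivAt (fun x : ℝ => (x : ℂ) ^ (n + 1)) (((n + 1 : ℕ) : ℂ) * (x : ℂ) ^ n) x := by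
        simpa using (hasDerivAt_pow (n + 1) (x : ℂ)).comp_ofReal
      refine ((hp.mul (hexp x)).const_mul (-(1 / r))).congr_deriv ?_
      push_cast
      field_simp
      ring
    have hint := integrableOn_pow_mul_cexp (n + 1) t
    have hint' := (integrableOn_pow_mul_cexp n t).const_mul ((n + 1) / r)
    have := integral_Ioi_of_hasDerivAt_of_tendsto (hd 0).continuousAt.continuousWithinAt
      (fun x _ => hd x) (hint.sub hint') (hlim (n + 1))
    rw [integral_sub hint hint', integral_const_mul, ih, sub_eq_iff_eq_add] at this
    rw [this, Nat.factorial_succ]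
    simp
    field_simp
    ring

/-- Laws are identified below through characteristic functions. The power structure makes a sum of
independent Exp(1) variables a Gamma variable. -/
lemma charFun_gammaMeasure (n : ℕ) (t : ℝ) :
    charFun (gammaMeasure (n + 1) 1) t = (1 / (1 - t * Complex.I)) ^ (n + 1) := by
  rw [charFun_apply_real, integral_gammaMeasure (by positivity)]
  have : ∫ x in Set.Ioi (0 : ℝ),
        (Real.exp (-x) * x ^ ((n + 1 : ℝ) - 1)) • Complex.exp (t * x * Complex.I)
      = n.factorial * (1 / (1 - t * Complex.I)) ^ (n + 1) := by
    rw [← integral_pow_mul_cexp]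
    refine setIntegral_congr_fun measurableSet_Ioi fun x (hx : 0 < x) => ?_
    rw [Complex.real_smul, Complex.ofReal_mul, Complex.ofReal_exp, add_sub_cancel_right,
      Real.rpow_natCast, show -(1 - t * Complex.I) * x = ((-x : ℝ) : ℂ) + t * x * Complex.I by
        push_cast; ring, Complex.exp_add]
    push_cast
    ring
  rw [this, Complex.real_smul, Real.Gamma_nat_eq_factorial, Complex.ofReal_inv,
    Complex.ofReal_natCast, inv_mul_cancel_left₀ (by exact_mod_cast n.factorial_ne_zero)]

lemma charFun_gammaMeasure_natCast {n : ℕ} (hn : 0 < n) (t : ℝ) :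
    charFun (gammaMeasure n 1) t = (1 / (1 - t * Complex.I)) ^ n := by
  obtain ⟨m, rfl⟩ := Nat.exists_eq_add_one_of_ne_zero hn.ne'
  exact_mod_cast charFun_gammaMeasure m t

lemma charFun_gammaMeasure_one (t : ℝ) :
    charFun (gammaMeasure 1 1) t = 1 / (1 - t * Complex.I) := by
  simpa using charFun_gammaMeasure_natCast one_pos t

/-! ### The complex Gaussian law -/

instance : IsProbabilityMeasure complexGaussian :=
  Measure.isProbabilityMeasure_map (by fun_prop)

lemma integral_complexGaussian_mul (f g : ℝ → ℂ) :
    ∫ z, f z.re * g z.im ∂complexGaussian =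
      (∫ x, f x ∂(gaussianReal 0 (1 / 2))) * ∫ x, g x ∂(gaussianReal 0 (1 / 2)) := by
  rw [complexGaussian, integral_map_equiv, ← integral_prod_mul]
  rfl

lemma charFun_complexGaussian (t : ℂ) :
    charFun complexGaussian t = Complex.exp (-(‖t‖ ^ 2 : ℝ) / 4) := by
  have h : ∀ z : ℂ, Complex.exp ((inner ℝ z t : ℝ) * Complex.I) =
      Complex.exp (t.re * z.re * Complex.I) * Complex.exp (t.im * z.im * Complex.I) := by
    intro z
    rw [← Complex.exp_add]
    simp only [Complex.inner, Complex.mul_re, Complex.conj_re, Complex.conj_im]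
    push_cast
    ring_nf
  rw [charFun_apply]
  simp_rw [h]
  rw [integral_complexGaussian_mul (fun x => Complex.exp (t.re * x * Complex.I))
    (fun x => Complex.exp (t.im * x * Complex.I)), ← charFun_apply_real, ← charFun_apply_real,
    charFun_gaussianReal, charFun_gaussianReal, ← Complex.exp_add, Complex.sq_norm,
    Complex.normSq_apply]
  push_cast
  ring_nf

lemma complexGaussian_map_neg : complexGaussian.map (fun z => -z) = complexGaussian := by
  have : IsProbabilityMeasure (complexGaussian.map (fun z => -z)) :=
    Measure.isProbabilityMeasure_map (by fun_prop)
  refine Measure.ext_of_charFun (funext fun t => ?_)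
  have := charFun_map_smul (μ := complexGaussian) (-1 : ℝ) t
  simp only [neg_smul, one_smul] at this
  rw [this, charFun_complexGaussian, charFun_complexGaussian, norm_neg]

/-- Follows from the symmetry `z ↦ -z`. No integrability is needed, since the change of variables
and `integral_neg` hold unconditionally. -/
lemma integral_complexGaussian_eq_zero_of_odd {f : ℂ → ℂ} (hf : ∀ z, f (-z) = -f z) :
    ∫ z, f z ∂complexGaussian = 0 := by
  have h : ∫ z, f z ∂complexGaussian = ∫ z, f (-z) ∂complexGaussian := by
    conv_lhs => rw [← complexGaussian_map_neg]
    exact integral_map_equiv (MeasurableEquiv.neg ℂ) f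
  simp_rw [hf, integral_neg] at h
  exact self_eq_neg.mp h

/-- With variance `1/2` the density is `π^(-1/2) e^(-x²)`, so the integrand is a Gaussian with
complex parameter `1 - it`. The square root disappears later, when real and imaginary parts
contribute one factor each. -/
lemma integral_cexp_mul_sq_gaussianReal (t : ℝ) :
    ∫ x, Complex.exp (t * x ^ 2 * Complex.I) ∂(gaussianReal 0 (1 / 2)) =
      (Real.sqrt Real.pi : ℂ)⁻¹ * (Real.pi / (1 - t * Complex.I)) ^ (1 / 2 : ℂ) := by
  rw [← integral_gaussian_complex (by simp), integral_gaussianReal_eq_integral_smul (by simp),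
    ← integral_const_mul]
  refine integral_congr_ae (ae_of_all _ fun x => ?_)
  simp only [gaussianPDFReal, Complex.real_smul, Complex.ofReal_mul, Complex.ofReal_exp]
  rw [mul_assoc, ← Complex.exp_add]
  push_cast
  congr 2
  · norm_num
    rw [mul_right_comm, mul_inv_cancel₀ (by simp), one_mul]
  · ring

lemma hasLaw_sq_norm_complexGaussian :
    HasLaw (fun z : ℂ => ‖z‖ ^ 2) (gammaMeasure 1 1) complexGaussian where
  map_eq := by
    have : IsProbabilityMeasure (gammaMeasure 1 1) :=
      isProbabilityMeasure_gammaMeasure one_pos one_pos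
    have : IsProbabilityMeasure (complexGaussian.map (fun z => ‖z‖ ^ 2)) :=
      Measure.isProbabilityMeasure_map (by fun_prop)
    refine Measure.ext_of_charFun (funext fun t => ?_)
    rw [charFun_gammaMeasure_one, charFun_apply_real,
      integral_map (by fun_prop) (by fun_prop)]
    have h : ∀ z : ℂ, Complex.exp (t * (‖z‖ ^ 2 : ℝ) * Complex.I) =
        Complex.exp (t * z.re ^ 2 * Complex.I) * Complex.exp (t * z.im ^ 2 * Complex.I) := by
      intro z
      rw [← Complex.exp_add, Complex.sq_norm, Complex.normSq_apply]
      push_cast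
      ring_nf
    simp_rw [h]
    rw [integral_complexGaussian_mul (fun x => Complex.exp (t * x ^ 2 * Complex.I))
      (fun x => Complex.exp (t * x ^ 2 * Complex.I)), integral_cexp_mul_sq_gaussianReal, ← sq,
      mul_pow, one_div (2 : ℂ), show (2 : ℂ) = (2 : ℕ) by norm_num,
      Complex.cpow_nat_inv_pow _ two_ne_zero, inv_pow, ← Complex.ofReal_pow,
      Real.sq_sqrt Real.pi_pos.le]
    have : (Real.pi : ℂ) ≠ 0 := by exact_mod_cast Real.pi_pos.ne'
    field_simp

lemma _root_.ProbabilityTheory.HasLaw.integrable_comp_iff {Ω α E : Type*}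
    [MeasurableSpace Ω] [MeasurableSpace α]
    [NormedAddCommGroup E] {P : Measure Ω} {μ : Measure α} {X : Ω → α} (hX : HasLaw X μ P)
    {f : α → E} (hf : AEStronglyMeasurable f μ) :
    Integrable (fun ω => f (X ω)) P ↔ Integrable f μ := by
  rw [← hX.map_eq] at hf ⊢
  exact (integrable_map_measure hf hX.aemeasurable).symm

lemma integrable_norm_sq_pow_complexGaussian (k : ℕ) :
    Integrable (fun z : ℂ => (‖z‖ ^ 2) ^ k) complexGaussian :=
  (hasLaw_sq_norm_complexGaussian.integrable_comp_iff (f := fun x => x ^ k)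
    (by fun_prop)).mpr (integrable_pow_gammaMeasure one_pos k)

lemma integral_norm_sq_pow_complexGaussian (k : ℕ) :
    ∫ z : ℂ, (‖z‖ ^ 2) ^ k ∂complexGaussian = k.factorial := by
  rw [show (fun z : ℂ => (‖z‖ ^ 2) ^ k) = (fun x => x ^ k) ∘ (fun z : ℂ => ‖z‖ ^ 2) from rfl,
    hasLaw_sq_norm_complexGaussian.integral_comp (by fun_prop),
    integral_pow_gammaMeasure one_pos, Real.Gamma_one, div_one, add_comm,
    Real.Gamma_nat_eq_factorial]

/-! ### Vectors of independent complex Gaussians -/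

section Pi

variable {ι : Type*} [Fintype ι]

lemma hasLaw_sum_sq_norm_pi [Nonempty ι] :
    HasLaw (fun z : ι → ℂ => ∑ i, ‖z i‖ ^ 2) (gammaMeasure (Fintype.card ι) 1)
      (Measure.pi fun _ => complexGaussian) where
  aemeasurable := (by fun_prop : Measurable (fun z : ι → ℂ => ∑ i, ‖z i‖ ^ 2)).aemeasurable
  map_eq := by
    have hm : Measurable (fun z : ι → ℂ => ∑ i, ‖z i‖ ^ 2) := by fun_prop
    have hc : (0 : ℝ) < Fintype.card ι := by exact_mod_cast Fintype.card_pos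
    have : IsProbabilityMeasure (gammaMeasure (Fintype.card ι) 1) :=
      isProbabilityMeasure_gammaMeasure hc one_pos
    have : IsProbabilityMeasure ((Measure.pi fun _ : ι => complexGaussian).map
        (fun z : ι → ℂ => ∑ i, ‖z i‖ ^ 2)) :=
      Measure.isProbabilityMeasure_map hm.aemeasurable
    refine Measure.ext_of_charFun (funext fun t => ?_)
    rw [charFun_gammaMeasure_natCast Fintype.card_pos, charFun_apply_real, integral_map hm.aemeasurable (by fun_prop)]
    have h1 : ∫ z : ℂ, Complex.exp (t * (‖z‖ ^ 2 : ℝ) * Complex.I) ∂complexGaussian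
        = 1 / (1 - t * Complex.I) := by
      have := charFun_gammaMeasure_one t
      rw [← hasLaw_sq_norm_complexGaussian.map_eq, charFun_apply_real,
        integral_map (by fun_prop) (by fun_prop)] at this
      exact this
    simp_rw [Complex.ofReal_sum, Finset.mul_sum, Finset.sum_mul, Complex.exp_sum]
    rw [integral_fintype_prod_eq_prod
      (f := fun _ (z : ℂ) => Complex.exp (t * (‖z‖ ^ 2 : ℝ) * Complex.I))]
    simp_rw [h1, Finset.prod_const, Finset.card_univ]

/-- The characteristic functions multiply, and their exponents `-‖w i‖²‖t‖²/4` add up to `-‖t‖²/4`.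
-/
lemma hasLaw_sum_mul_pi {w : ι → ℂ} (hw : ∑ i, ‖w i‖ ^ 2 = 1) :
    HasLaw (fun z : ι → ℂ => ∑ i, z i * w i) complexGaussian
      (Measure.pi fun _ => complexGaussian) where
  aemeasurable := (by fun_prop : Measurable (fun z : ι → ℂ => ∑ i, z i * w i)).aemeasurable
  map_eq := by
    have hm : Measurable (fun z : ι → ℂ => ∑ i, z i * w i) := by fun_prop
    have : IsProbabilityMeasure ((Measure.pi fun _ : ι => complexGaussian).map
        (fun z : ι → ℂ => ∑ i, z i * w i)) :=
      Measure.isProbabilityMeasure_map hm.aemeasurable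
    refine Measure.ext_of_charFun (funext fun t => ?_)
    rw [charFun_complexGaussian, charFun_apply, integral_map hm.aemeasurable (by fun_prop)]
    have h : ∀ a b : ℂ, inner ℝ (a * b) t = inner ℝ a (starRingEnd ℂ b * t) := by
      intro a b
      simp only [Complex.inner, map_mul]
      ring_nf
    simp_rw [sum_inner, h, Complex.ofReal_sum, Finset.sum_mul, Complex.exp_sum]
    rw [integral_fintype_prod_eq_prod
      (f := fun i (z : ℂ) =>
        Complex.exp ((inner ℝ z (starRingEnd ℂ (w i) * t) : ℝ) * Complex.I))]
    simp_rw [← charFun_apply, charFun_complexGaussian]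
    rw [← Complex.exp_sum]
    congr 1
    simp_rw [norm_mul, mul_pow, RCLike.norm_conj, neg_div]
    rw [Finset.sum_neg_distrib, ← Finset.sum_div, ← Complex.ofReal_sum, ← Finset.sum_mul, hw,
      one_mul]

lemma norm_sum_mul_sq_le {w : ι → ℂ} (hw : ∑ i, ‖w i‖ ^ 2 = 1) (z : ι → ℂ) :
    ‖∑ i, z i * w i‖ ^ 2 ≤ ∑ i, ‖z i‖ ^ 2 := by
  calc ‖∑ i, z i * w i‖ ^ 2 ≤ (∑ i, ‖z i‖ * ‖w i‖) ^ 2 := by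
        gcongr
        exact (norm_sum_le _ _).trans_eq (by simp)
    _ ≤ (∑ i, ‖z i‖ ^ 2) * ∑ i, ‖w i‖ ^ 2 := Finset.sum_mul_sq_le_sq_mul_sq _ _ _
    _ = _ := by rw [hw, mul_one]

lemma integrable_norm_sum_mul_sq_mul_sum {w : ι → ℂ} (hw : ∑ i, ‖w i‖ ^ 2 = 1) :
    Integrable (fun z : ι → ℂ => ‖∑ i, z i * w i‖ ^ 2 * ∑ i, ‖z i‖ ^ 2)
      (Measure.pi fun _ => complexGaussian) := by
  have : Nonempty ι := by
    by_contra h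
    rw [not_nonempty_iff] at h
    simp at hw
  have hc : (0 : ℝ) < Fintype.card ι := by exact_mod_cast Fintype.card_pos
  refine ((hasLaw_sum_sq_norm_pi.integrable_comp_iff (f := fun x => x ^ 2)
    (by fun_prop)).mpr (integrable_pow_gammaMeasure hc 2)).mono' (by fun_prop)
    (ae_of_all _ fun z => ?_)
  rw [Real.norm_of_nonneg (by positivity), sq (∑ i, ‖z i‖ ^ 2)]
  gcongr
  exact norm_sum_mul_sq_le hw z

variable [DecidableEq ι]

/-- The factor at one coordinate `l` of a fourth-order monomial; `a`, `b`, `c` stand for `l = j`, `l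
= k`, `l = i`. It is dominated by `(1 + ‖z‖²)²`. -/
lemma integrable_mul_conj_mul_norm_sq (a b c : Prop) [Decidable a] [Decidable b] [Decidable c] :
    Integrable (fun z : ℂ => (if a then z else 1) * (if b then starRingEnd ℂ z else 1) *
      (if c then ((‖z‖ ^ 2 : ℝ) : ℂ) else 1)) complexGaussian := by
  have hb := ((integrable_const (1 : ℝ)).add
    ((integrable_norm_sq_pow_complexGaussian 1).const_mul 2)).add
    (integrable_norm_sq_pow_complexGaussian 2)
  refine hb.mono' ?_ (ae_of_all _ fun z => ?_)
  · split_ifs <;> fun_prop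
  · simp only [Pi.add_apply]
    rw [norm_mul, norm_mul]
    have h1 : ‖(if a then z else 1)‖ ≤ max 1 ‖z‖ := by split_ifs <;> simp
    have h2 : ‖(if b then starRingEnd ℂ z else 1)‖ ≤ max 1 ‖z‖ := by split_ifs <;> simp
    have h3 : ‖(if c then ((‖z‖ ^ 2 : ℝ) : ℂ) else 1)‖ ≤ 1 + ‖z‖ ^ 2 := by
      split_ifs
      · rw [Complex.norm_real, Real.norm_of_nonneg (by positivity)]; linarith
      · simp
    have h4 : max 1 ‖z‖ * max 1 ‖z‖ ≤ 1 + ‖z‖ ^ 2 := by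
      rcases max_choice 1 ‖z‖ with h | h <;> rw [h] <;> nlinarith [sq_nonneg ‖z‖]
    calc _ ≤ max 1 ‖z‖ * max 1 ‖z‖ * (1 + ‖z‖ ^ 2) := by gcongr
      _ ≤ (1 + ‖z‖ ^ 2) * (1 + ‖z‖ ^ 2) := by gcongr
      _ = _ := by ring

lemma mul_conj_mul_norm_sq_eq_prod (i j k : ι) (z : ι → ℂ) :
    z j * starRingEnd ℂ (z k) * (‖z i‖ ^ 2 : ℝ) =
      ∏ l, (if l = j then z l else 1) * (if l = k then starRingEnd ℂ (z l) else 1) *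
        (if l = i then ((‖z l‖ ^ 2 : ℝ) : ℂ) else 1) := by
  rw [Finset.prod_mul_distrib, Finset.prod_mul_distrib]
  simp

lemma integrable_mul_conj_mul_norm_sq_pi (i j k : ι) :
    Integrable (fun z : ι → ℂ => z j * starRingEnd ℂ (z k) * (‖z i‖ ^ 2 : ℝ))
      (Measure.pi fun _ => complexGaussian) := by
  simp_rw [mul_conj_mul_norm_sq_eq_prod]
  exact Integrable.fintype_prod_dep (f := fun l (z : ℂ) => (if l = j then z else 1) *
    (if l = k then starRingEnd ℂ z else 1) * (if l = i then ((‖z‖ ^ 2 : ℝ) : ℂ) else 1))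
    fun l => integrable_mul_conj_mul_norm_sq _ _ _

lemma integral_mul_conj_mul_norm_sq_pi (i j k : ι) :
    ∫ z : ι → ℂ, z j * starRingEnd ℂ (z k) * (‖z i‖ ^ 2 : ℝ)
      ∂(Measure.pi fun _ => complexGaussian) =
      if j = k then (if i = j then 2 else 1) else 0 := by
  simp_rw [mul_conj_mul_norm_sq_eq_prod]
  rw [integral_fintype_prod_eq_prod (f := fun l (z : ℂ) => (if l = j then z else 1) *
    (if l = k then starRingEnd ℂ z else 1) * (if l = i then ((‖z‖ ^ 2 : ℝ) : ℂ) else 1))]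
  have hpow (n : ℕ) : ∫ z : ℂ, ((((‖z‖ ^ 2) ^ n : ℝ)) : ℂ) ∂complexGaussian = n.factorial := by
    rw [integral_complex_ofReal, integral_norm_sq_pow_complexGaussian]
    simp
  have hc (z : ℂ) : z * starRingEnd ℂ z = ((‖z‖ ^ 2 : ℝ) : ℂ) := by
    rw [Complex.mul_conj, Complex.normSq_eq_norm_sq]
  split_ifs with hjk hij
  · subst hjk hij
    rw [Finset.prod_eq_single i]
    · have := hpow 2
      simp only [if_true, hc]
      simp_rw [sq (‖_‖ ^ 2 : ℝ)] at this
      push_cast at this ⊢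
      rw [this]
      norm_num
    · intro l _ hl
      simp [hl]
    · simp
  · subst hjk
    refine Finset.prod_eq_one fun l _ => ?_
    have h1 := hpow 1
    simp only [pow_one] at h1
    by_cases hlj : l = j
    · have hli : l ≠ i := fun h => hij (h.symm.trans hlj)
      simp [hlj, hc, -Complex.ofReal_pow, h1, Ne.symm hij]
    · by_cases hli : l = i
      · simp [hij, hli, -Complex.ofReal_pow, h1]
      · simp [hlj, hli]
  -- For `j ≠ k` the factor at coordinate `j` is `z` times an even function, hence odd.
  · refine Finset.prod_eq_zero (Finset.mem_univ j) ?_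
    refine integral_complexGaussian_eq_zero_of_odd fun z => ?_
    simp only [if_true, if_neg hjk, norm_neg]
    ring

/-- After expansion only `j = k` survives, leaving `∑ i, ∑ j, ‖w j‖² (1 + δ_ij)`; the extra `1`
comes from `E|z|⁴ = 2`. -/
lemma integral_norm_sum_mul_sq_mul_sum {w : ι → ℂ} (hw : ∑ i, ‖w i‖ ^ 2 = 1) :
    ∫ z : ι → ℂ, ‖∑ i, z i * w i‖ ^ 2 * ∑ i, ‖z i‖ ^ 2
      ∂(Measure.pi fun _ => complexGaussian) = Fintype.card ι + 1 := by
  have hexp (z : ι → ℂ) : ((‖∑ i, z i * w i‖ ^ 2 * ∑ i, ‖z i‖ ^ 2 : ℝ) : ℂ) =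
      ∑ i, ∑ j, ∑ k, (w j * starRingEnd ℂ (w k)) *
        (z j * starRingEnd ℂ (z k) * (‖z i‖ ^ 2 : ℝ)) := by
    rw [Complex.ofReal_mul, ← Complex.normSq_eq_norm_sq, ← Complex.mul_conj, map_sum,
      Finset.sum_mul_sum, Complex.ofReal_sum, Finset.mul_sum]
    refine Finset.sum_congr rfl fun i _ => ?_
    rw [Finset.sum_mul]
    refine Finset.sum_congr rfl fun j _ => ?_
    rw [Finset.sum_mul]
    refine Finset.sum_congr rfl fun k _ => ?_
    rw [map_mul]
    ring
  have hint (i j k : ι) := (integrable_mul_conj_mul_norm_sq_pi i j k).const_mul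
    (w j * starRingEnd ℂ (w k))
  have hw' : ∑ i, w i * starRingEnd ℂ (w i) = 1 := by
    simp_rw [Complex.mul_conj, Complex.normSq_eq_norm_sq]
    exact_mod_cast hw
  apply Complex.ofReal_injective
  rw [← integral_complex_ofReal]
  simp_rw [hexp]
  rw [integral_finsetSum _ fun i _ => integrable_finsetSum _ fun j _ =>
    integrable_finsetSum _ fun k _ => hint i j k]
  simp_rw [integral_finsetSum _ fun j _ => integrable_finsetSum _ fun k _ => hint _ j k,
    integral_finsetSum _ fun k _ => hint _ _ k, integral_const_mul,
    integral_mul_conj_mul_norm_sq_pi]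
  have (i j : ι) : (if i = j then (2 : ℂ) else 1) = 1 + if i = j then 1 else 0 := by
    split_ifs <;> norm_num
  simp [this, mul_add, Finset.sum_add_distrib, hw']

end Pi

/-! ### Alternating binomial sums and closed forms of the constants -/

/-- Pascal's rule, as a finite-difference recursion. The shift in `f` is why the next two inductions
keep `k` general. -/
lemma sum_range_choose_succ_mul_neg_one_pow (n : ℕ) (f : ℕ → ℝ) :
    ∑ i ∈ Finset.range (n + 2), (Nat.choose (n + 1) i : ℝ) * (-1) ^ i * f i =
      ∑ i ∈ Finset.range (n + 1), (Nat.choose n i : ℝ) * (-1) ^ i * f i -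
        ∑ i ∈ Finset.range (n + 1), (Nat.choose n i : ℝ) * (-1) ^ i * f (i + 1) := by
  rw [Finset.sum_range_succ' _ (n + 1)]
  have h : ∑ i ∈ Finset.range (n + 1), (Nat.choose n i : ℝ) * (-1) ^ i * f i =
      ∑ i ∈ Finset.range (n + 1), (Nat.choose n (i + 1) : ℝ) * (-1) ^ (i + 1) * f (i + 1) +
        f 0 := by
    have := Finset.sum_range_succ' (fun i => (Nat.choose n i : ℝ) * (-1) ^ i * f i) (n + 1)
    rw [Finset.sum_range_succ _ (n + 1)] at this
    simpa using this
  rw [h, add_sub_right_comm, ← Finset.sum_sub_distrib]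
  simp only [Nat.choose_succ_succ, Nat.cast_add, Nat.choose_zero_right, Nat.cast_one, pow_zero,
    one_mul]
  congr 1
  exact Finset.sum_congr rfl fun i _ => by ring

/-- The value is the Beta integral `∫₀¹ x^k (1-x)^n dx`. -/
lemma sum_range_choose_mul_inv (n k : ℕ) :
    ∑ i ∈ Finset.range (n + 1), (Nat.choose n i : ℝ) * (-1) ^ i * (1 / ((k + 1 + i : ℕ) : ℝ)) =
      (n.factorial : ℝ) * k.factorial / (n + k + 1).factorial := by
  induction n generalizing k with
  | zero => simp [Nat.factorial_succ]; field_simp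
  | succ n ih =>
    have h2 := ih (k + 1)
    simp_rw [show ∀ i, k + 1 + 1 + i = k + 1 + (i + 1) by intro i; ring] at h2
    rw [sum_range_choose_succ_mul_neg_one_pow n (fun i => 1 / ((k + 1 + i : ℕ) : ℝ)), ih, h2,
      show n + (k + 1) + 1 = (n + k + 1) + 1 by ring, show n + 1 + k + 1 = (n + k + 1) + 1 by ring,
      Nat.factorial_succ (n + k + 1), Nat.factorial_succ k, Nat.factorial_succ n]
    push_cast
    field_simp
    ring

/-- Formally, minus the derivative in `k` of the preceding Beta value. -/
lemma sum_range_choose_mul_inv_sq (n k : ℕ) :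
    ∑ i ∈ Finset.range (n + 1), (Nat.choose n i : ℝ) * (-1) ^ i * (1 / ((k + 1 + i : ℕ) : ℝ) ^ 2) =
      (n.factorial : ℝ) * k.factorial / (n + k + 1).factorial *
        (harmonic (n + k + 1) - harmonic k : ℚ) := by
  induction n generalizing k with
  | zero => simp [Nat.factorial_succ, harmonic_succ]; field_simp
  | succ n ih =>
    have h2 := ih (k + 1)
    simp_rw [show ∀ i, k + 1 + 1 + i = k + 1 + (i + 1) by intro i; ring] at h2
    rw [sum_range_choose_succ_mul_neg_one_pow n (fun i => 1 / ((k + 1 + i : ℕ) : ℝ) ^ 2), ih, h2,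
      show n + (k + 1) + 1 = (n + k + 1) + 1 by ring, show n + 1 + k + 1 = (n + k + 1) + 1 by ring,
      Nat.factorial_succ (n + k + 1), Nat.factorial_succ k, Nat.factorial_succ n,
      harmonic_succ (n + k + 1), harmonic_succ k]
    push_cast
    field_simp
    ring

lemma range_succ_eq_Icc_zero (n : ℕ) : Finset.range (n + 1) = Finset.Icc 0 n := by
  ext; simp

/-- Taking `k = 0` and `n = N - 2`, the subtracted term is `H_{N-1}`, which cancels one of the two
harmonic sums. -/
lemma m3_eq (p : Params) {N : ℕ} (hN : 2 ≤ N) :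
    m3 p N = Real.log p.c1 + 2 * psiOne + ∑ m ∈ Finset.Icc 1 (N - 1), 1 / (m : ℝ) := by
  obtain ⟨n, rfl⟩ := Nat.exists_eq_add_of_le' hN
  have h := sum_range_choose_mul_inv_sq n 0
  have hH : (harmonic (n + 1) : ℝ) = ∑ m ∈ Finset.Icc 1 (n + 1), 1 / (m : ℝ) := by
    rw [harmonic_eq_sum_Icc]
    simp
  rw [range_succ_eq_Icc_zero] at h
  simp only [zero_add, add_zero, harmonic_zero, sub_zero, hH, Nat.factorial_zero, Nat.cast_one,
    mul_one, Nat.factorial_succ] at h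
  simp only [m3, Nat.add_sub_cancel, show n + 2 - 1 = n + 1 by omega]
  have h' : ∑ i ∈ Finset.Icc 0 n, (Nat.choose n i : ℝ) * (-1) ^ i * (1 / ((i : ℝ) + 1) ^ 2) =
      1 / (n + 1) * ∑ m ∈ Finset.Icc 1 (n + 1), 1 / (m : ℝ) := by
    rw [← hH] at h ⊢
    convert h using 1
    · exact Finset.sum_congr rfl fun i _ => by push_cast; ring
    · push_cast
      field_simp
  rw [h', show ((n + 2 : ℕ) : ℝ) - 1 = n + 1 by push_cast; ring]
  field_simp
  ring

lemma sum_range_add_one (n : ℕ) :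
    ∑ m ∈ Finset.range n, ((m : ℝ) + 1) = n * (n + 1) / 2 := by
  induction n with
  | zero => simp
  | succ n ih => rw [Finset.sum_range_succ, ih]; push_cast; ring

/-- Here `Γ(m+2)/m! = m + 1`, the sum over `i` with `k = 1` gives `1/(2N(N-1))`, and the `m + 1` add
up to `N(N+1)/2`. -/
lemma m5_eq (p : Params) {N : ℕ} (hN : 2 ≤ N) : m5 p N = p.c1 * (N + 1) := by
  obtain ⟨n, rfl⟩ := Nat.exists_eq_add_of_le' hN
  have h := sum_range_choose_mul_inv n 1
  rw [range_succ_eq_Icc_zero] at h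
  simp only [m5, Nat.add_sub_cancel, show n + 2 - 1 = n + 1 by omega]
  have h1 (m : ℕ) : 1 / (m.factorial : ℝ) * ∑ i ∈ Finset.Icc 0 n, (Nat.choose n i : ℝ) * (-1) ^ i *
      (Real.Gamma ((m : ℝ) + 2) / (2 * (i : ℝ) + 4)) =
      (m + 1) * (1 / (2 * ((n + 1) * (n + 2)))) := by
    have hg : Real.Gamma ((m : ℝ) + 2) = (m + 1) * m.factorial := by
      rw [show (m : ℝ) + 2 = ((m + 1 : ℕ) : ℝ) + 1 by push_cast; ring,
        Real.Gamma_nat_eq_factorial, Nat.factorial_succ]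
      push_cast
      ring
    have hs : ∑ i ∈ Finset.Icc 0 n, (Nat.choose n i : ℝ) * (-1) ^ i *
        (Real.Gamma ((m : ℝ) + 2) / (2 * (i : ℝ) + 4)) = Real.Gamma ((m : ℝ) + 2) / 2 *
        ∑ i ∈ Finset.Icc 0 n, (Nat.choose n i : ℝ) * (-1) ^ i *
          (1 / ((1 + 1 + i : ℕ) : ℝ)) := by
      rw [Finset.mul_sum]
      refine Finset.sum_congr rfl fun i _ => ?_
      push_cast
      field_simp
      ring
    rw [hs, h, hg, Nat.factorial_succ (n + 1), Nat.factorial_succ n]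
    push_cast
    have : (m.factorial : ℝ) ≠ 0 := by positivity
    field_simp
    norm_num
    ring
  simp_rw [h1]
  rw [← Finset.sum_mul, ← range_succ_eq_Icc_zero, sum_range_add_one]
  push_cast
  field_simp
  ring

/-! ### Tangent inequalities behind Jensen -/

/-- The supporting plane at `(m, n)` of a convex function. It is weighted AM-GM with weights `1/S`,
`e^m/S`, `e^n/S`, the last two being the partial derivatives. -/
lemma log_one_add_exp_add_exp_ge (m n u v : ℝ) :
    Real.log (1 + Real.exp m + Real.exp n) +
        Real.exp m / (1 + Real.exp m + Real.exp n) * (u - m) +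
        Real.exp n / (1 + Real.exp m + Real.exp n) * (v - n) ≤
      Real.log (1 + Real.exp u + Real.exp v) := by
  set S := 1 + Real.exp m + Real.exp n with hS
  have hSpos : 0 < S := by positivity
  have h := Real.geom_mean_le_arith_mean3_weighted (w₁ := 1 / S) (w₂ := Real.exp m / S)
    (w₃ := Real.exp n / S) (p₁ := 1) (p₂ := Real.exp (u - m)) (p₃ := Real.exp (v - n))
    (by positivity) (by positivity) (by positivity) (by positivity) (by positivity) (by positivity)
    (by rw [← add_div, ← add_div, div_self hSpos.ne'])
  rw [Real.one_rpow, one_mul, ← Real.exp_mul, ← Real.exp_mul, ← Real.exp_add, Real.exp_sub,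
    Real.exp_sub] at h
  have h2 : 1 / S * 1 + Real.exp m / S * (Real.exp u / Real.exp m) +
      Real.exp n / S * (Real.exp v / Real.exp n) = (1 + Real.exp u + Real.exp v) / S := by
    field_simp
  rw [h2, ← Real.le_log_iff_exp_le (by positivity), Real.log_div (by positivity) hSpos.ne'] at h
  linarith

lemma log_one_add_le_tangent {x y : ℝ} (hx : 0 ≤ x) (hy : 0 ≤ y) :
    Real.log (1 + x) ≤ Real.log (1 + y) + (x - y) / (1 + y) := by
  have h := Real.log_le_sub_one_of_pos (x := (1 + x) / (1 + y)) (by positivity)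
  rw [Real.log_div (by positivity) (by positivity)] at h
  have : (1 + x) / (1 + y) - 1 = (x - y) / (1 + y) := by field_simp; ring
  linarith

/-! ### Logarithmic means and the Jensen bound -/

section Ergodic

variable {Ω : Type*} [MeasurableSpace Ω] {P : Measure Ω}

lemma integrable_log_of_hasLaw_gamma {X : Ω → ℝ} {a : ℝ} (ha : 0 < a)
    (hX : HasLaw X (gammaMeasure a 1) P) : Integrable (fun ω => Real.log (X ω)) P :=
  (hX.integrable_comp_iff (by fun_prop)).mpr (integrable_log_gammaMeasure ha)

lemma integral_log_of_hasLaw_gamma {X : Ω → ℝ} {n : ℕ} (hn : 0 < n)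
    (hX : HasLaw X (gammaMeasure n 1) P) :
    ∫ ω, Real.log (X ω) ∂P = psiOne + ∑ m ∈ Finset.Icc 1 (n - 1), 1 / (m : ℝ) := by
  obtain ⟨m, rfl⟩ := Nat.exists_eq_add_one_of_ne_zero hn.ne'
  have h := hX.integral_comp (f := Real.log) (by fun_prop)
  rw [Nat.cast_add_one, integral_log_gammaMeasure] at h
  exact h

lemma integral_log_of_hasLaw_gamma_one {X : Ω → ℝ} (hX : HasLaw X (gammaMeasure 1 1) P) :
    ∫ ω, Real.log (X ω) ∂P = psiOne := by
  simpa using integral_log_of_hasLaw_gamma (n := 1) one_pos (by simpa using hX)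

lemma ae_pos_of_hasLaw_gamma {X : Ω → ℝ} {a : ℝ} (hX : HasLaw X (gammaMeasure a 1) P) :
    ∀ᵐ ω ∂P, 0 < X ω :=
  (hX.ae_iff (p := fun x => 0 < x) (by fun_prop)).mpr (gammaMeasure_ae_pos a)

lemma integral_of_hasLaw_gamma {X : Ω → ℝ} {a : ℝ} (ha : 0 < a)
    (hX : HasLaw X (gammaMeasure a 1) P) : ∫ ω, X ω ∂P = a := by
  have h := integral_pow_gammaMeasure ha 1
  have := hX.integral_eq
  simp only [pow_one, Nat.cast_one] at h
  rw [this, h, Real.Gamma_add_one ha.ne', mul_div_cancel_right₀ _ (Real.Gamma_pos_of_pos ha).ne']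

lemma integrable_of_hasLaw_gamma {X : Ω → ℝ} {a : ℝ} (ha : 0 < a)
    (hX : HasLaw X (gammaMeasure a 1) P) : Integrable X P :=
  (hX.integrable_comp_iff (f := fun x => x) (by fun_prop)).mpr
    (by simpa using integrable_pow_gammaMeasure ha 1)

lemma integrable_sq_of_hasLaw_gamma {X : Ω → ℝ} {a : ℝ} (ha : 0 < a)
    (hX : HasLaw X (gammaMeasure a 1) P) : Integrable (fun ω => X ω ^ 2) P :=
  (hX.integrable_comp_iff (f := fun x => x ^ 2) (by fun_prop)).mpr
    (integrable_pow_gammaMeasure ha 2)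

/-- The two-hop signal to noise ratio in terms of the link gains is log-integrable, and the mean
of its logarithm is bounded below through Jensen's inequality. -/
lemma integrable_log_relay_and_le_integral [IsProbabilityMeasure P] {N : ℕ} (hN : 0 < N)
    {a b c : ℝ} (ha : 0 < a) (hb : 0 < b) (hc : 0 < c) {X Y Z V : Ω → ℝ}
    (hX : HasLaw X (gammaMeasure N 1) P) (hY : HasLaw Y (gammaMeasure N 1) P)
    (hZ : HasLaw Z (gammaMeasure 1 1) P) (hV : HasLaw V (gammaMeasure 1 1) P)
    (hXZ : Integrable (fun ω => X ω * Z ω) P) (hXZ' : ∫ ω, X ω * Z ω ∂P = N)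
    (hVY : Integrable (fun ω => V ω * Y ω) P) (hVY' : ∫ ω, V ω * Y ω ∂P = N + 1) :
    Integrable (fun ω => Real.log (1 + (a * X ω ^ 2 +
      b * (X ω * Z ω) * (c * (V ω * Y ω)) / (b * (X ω * Z ω) + c * (V ω * Y ω) + 1)))) P ∧
    Real.log (1 + Real.exp (Real.log a + 2 * psiOne + 2 * ∑ m ∈ Finset.Icc 1 (N - 1), 1 / (m : ℝ))
      + Real.exp ((Real.log b + 2 * psiOne + ∑ m ∈ Finset.Icc 1 (N - 1), 1 / (m : ℝ)) +
        (Real.log c + 2 * psiOne + ∑ m ∈ Finset.Icc 1 (N - 1), 1 / (m : ℝ)) -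
          Real.log (1 + b * N + c * (N + 1)))) ≤
    ∫ ω, Real.log (1 + (a * X ω ^ 2 +
      b * (X ω * Z ω) * (c * (V ω * Y ω)) / (b * (X ω * Z ω) + c * (V ω * Y ω) + 1))) ∂P := by
  have hN' : (0 : ℝ) < N := by exact_mod_cast hN
  have hposX := ae_pos_of_hasLaw_gamma hX
  have hposY := ae_pos_of_hasLaw_gamma hY
  have hposZ := ae_pos_of_hasLaw_gamma hZ
  have hposV := ae_pos_of_hasLaw_gamma hV
  have mX := hX.aemeasurable
  have mY := hY.aemeasurable
  have mZ := hZ.aemeasurable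
  have mV := hV.aemeasurable
  have hint : Integrable (fun ω => Real.log (1 + (a * X ω ^ 2 +
      b * (X ω * Z ω) * (c * (V ω * Y ω)) / (b * (X ω * Z ω) + c * (V ω * Y ω) + 1)))) P := by
    -- Domination by `log(1 + x) ≤ x` and `BC/(B + C + 1) ≤ B`.
    refine (((integrable_sq_of_hasLaw_gamma hN' hX).const_mul a).add (hXZ.const_mul b)).mono'
      (AEMeasurable.aestronglyMeasurable (by fun_prop)) ?_
    filter_upwards [hposX, hposY, hposZ, hposV] with ω hx hy hz hv
    have h1 : 0 < b * (X ω * Z ω) := by positivity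
    have h2 : 0 < c * (V ω * Y ω) := by positivity
    have h3 : 0 ≤ a * X ω ^ 2 +
      b * (X ω * Z ω) * (c * (V ω * Y ω)) / (b * (X ω * Z ω) + c * (V ω * Y ω) + 1) := by
      positivity
    rw [Real.norm_of_nonneg (Real.log_nonneg (by linarith))]
    have h4 : b * (X ω * Z ω) * (c * (V ω * Y ω)) / (b * (X ω * Z ω) + c * (V ω * Y ω) + 1) ≤
        b * (X ω * Z ω) := by
      rw [div_le_iff₀ (by positivity)]
      gcongr
      linarith
    have h5 := Real.log_le_sub_one_of_pos (x := 1 + (a * X ω ^ 2 +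
      b * (X ω * Z ω) * (c * (V ω * Y ω)) / (b * (X ω * Z ω) + c * (V ω * Y ω) + 1)))
      (by linarith)
    simp only [Pi.add_apply]
    linarith
  refine ⟨hint, ?_⟩
  set H : ℝ := ∑ m ∈ Finset.Icc 1 (N - 1), 1 / (m : ℝ)
  set μ := Real.log a + 2 * psiOne + 2 * H with hμ
  set M := b * N + c * (N + 1) with hM
  set ν := (Real.log b + 2 * psiOne + H) + (Real.log c + 2 * psiOne + H) -
    Real.log (1 + b * N + c * (N + 1)) with hν
  have hMpos : 0 < M := by positivity
  set S := 1 + Real.exp μ + Real.exp ν with hS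
  have hlX := integrable_log_of_hasLaw_gamma hN' hX
  have hlY := integrable_log_of_hasLaw_gamma hN' hY
  have hlZ := integrable_log_of_hasLaw_gamma one_pos hZ
  have hlV := integrable_log_of_hasLaw_gamma one_pos hV
  have i1 : Integrable (fun ω => Real.log S + Real.exp μ / S *
      (Real.log a + 2 * Real.log (X ω) - μ)) P := by fun_prop
  have i2 : Integrable (fun ω => Real.log b + Real.log c + Real.log (X ω) + Real.log (Z ω)
        + Real.log (V ω) + Real.log (Y ω)
        - (Real.log (1 + M) + (b * (X ω * Z ω) + c * (V ω * Y ω) - M) / (1 + M)) - ν) P := by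
    fun_prop
  -- The point `μ` is the mean of `log(aX²)`, so the linear term integrates to zero.
  have e1 : ∫ ω, (Real.log S + Real.exp μ / S * (Real.log a + 2 * Real.log (X ω) - μ)) ∂P =
      Real.log S := by
    rw [integral_add (by fun_prop) (by fun_prop), integral_const_mul,
      integral_sub (by fun_prop) (by fun_prop), integral_add (by fun_prop) (by fun_prop),
      integral_const_mul, integral_log_of_hasLaw_gamma hN hX]
    simp only [integral_const, probReal_univ, one_smul]
    rw [hμ]
    ring
  -- Likewise `M` is the mean of `B + C`, which kills the tangent correction, and `ν` is the mean of
  -- what remains.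
  have e2 : ∫ ω, (Real.log b + Real.log c + Real.log (X ω) + Real.log (Z ω)
        + Real.log (V ω) + Real.log (Y ω)
        - (Real.log (1 + M) + (b * (X ω * Z ω) + c * (V ω * Y ω) - M) / (1 + M)) - ν) ∂P = 0 := by
    rw [integral_sub (by fun_prop) (by fun_prop), integral_sub (by fun_prop) (by fun_prop),
      integral_add (by fun_prop) (by fun_prop), integral_add (by fun_prop) (by fun_prop),
      integral_add (by fun_prop) (by fun_prop), integral_add (by fun_prop) (by fun_prop),
      integral_add (by fun_prop) (by fun_prop), integral_add (by fun_prop) (by fun_prop),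
      integral_div,
      integral_sub (by fun_prop) (by fun_prop), integral_add (by fun_prop) (by fun_prop),
      integral_const_mul, integral_const_mul, hXZ', hVY', integral_log_of_hasLaw_gamma hN hX,
      integral_log_of_hasLaw_gamma hN hY, integral_log_of_hasLaw_gamma_one hZ,
      integral_log_of_hasLaw_gamma_one hV]
    simp only [integral_const, probReal_univ, one_smul]
    rw [← hM, sub_self, zero_div, hν, add_assoc 1, ← hM]
    ring
  calc Real.log S = ∫ ω, ((Real.log S + Real.exp μ / S * (Real.log a + 2 * Real.log (X ω) - μ)) +
        Real.exp ν / S * (Real.log b + Real.log c + Real.log (X ω) + Real.log (Z ω)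
        + Real.log (V ω) + Real.log (Y ω)
        - (Real.log (1 + M) + (b * (X ω * Z ω) + c * (V ω * Y ω) - M) / (1 + M)) - ν)) ∂P := by
        rw [integral_add i1 (i2.const_mul _), integral_const_mul, e1, e2, mul_zero, add_zero]
    _ ≤ _ := by
      refine integral_mono_ae (i1.add (i2.const_mul _)) hint ?_
      filter_upwards [hposX, hposY, hposZ, hposV] with ω hx hy hz hv
      have hA : 0 < b * (X ω * Z ω) + c * (V ω * Y ω) := by positivity
      have ht := log_one_add_le_tangent hA.le hMpos.le
      have hj := log_one_add_exp_add_exp_ge μ ν (Real.log (a * X ω ^ 2))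
        (Real.log (b * (X ω * Z ω) * (c * (V ω * Y ω)) /
          (b * (X ω * Z ω) + c * (V ω * Y ω) + 1)))
      rw [Real.exp_log (by positivity), Real.exp_log (by positivity), ← hS, add_assoc 1] at hj
      refine le_trans ?_ hj
      -- A nonnegative slope in `v` allows `log(1 + B + C)` to be replaced by its larger tangent at
      -- `M`.
      have hq : 0 ≤ Real.exp ν / S := by positivity
      rw [Real.log_mul ha.ne' (by positivity), Real.log_pow,
        Real.log_div (by positivity) (by positivity), Real.log_mul (by positivity) (by positivity),
        Real.log_mul hb.ne' (by positivity), Real.log_mul hx.ne' hz.ne',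
        Real.log_mul hc.ne' (by positivity), Real.log_mul hv.ne' hy.ne']
      rw [add_comm 1 (b * (X ω * Z ω) + c * (V ω * Y ω))] at ht
      push_cast
      refine add_le_add le_rfl (mul_le_mul_of_nonneg_left ?_ hq)
      linarith

end Ergodic

/-! ### Conditioning on the first channel -/

section Product

variable {α β γ : Type*} [MeasurableSpace α] [MeasurableSpace β] [MeasurableSpace γ]

/-- Fubini: a conditional law that does not depend on the first coordinate is the unconditional law.
-/
lemma hasLaw_prod_of_forall_ae_section {μ : Measure α} [IsProbabilityMeasure μ] {ν : Measure β}
    [SFinite ν] {ρ : Measure γ} {F : α × β → γ} (hF : Measurable F)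
    (h : ∀ᵐ x ∂μ, HasLaw (fun y => F (x, y)) ρ ν) : HasLaw F ρ (μ.prod ν) where
  aemeasurable := hF.aemeasurable
  map_eq := by
    ext s hs
    rw [Measure.map_apply hF hs, Measure.prod_apply (hF hs)]
    have : ∀ᵐ x ∂μ, ν (Prod.mk x ⁻¹' (F ⁻¹' s)) = ρ s := by
      filter_upwards [h] with x hx
      rw [← hx.map_eq, Measure.map_apply (by fun_prop) hs]
      rfl
    rw [lintegral_congr_ae this]
    simp

variable {ι : Type*} [Fintype ι]

/-- Given independent Gaussian channels, a beam that depends on the first one only sees an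
exponentially distributed gain of the second one. -/
lemma hasLaw_norm_sq_sum_mul_prod {w : (ι → ℂ) → ι → ℂ} (hwm : Measurable w)
    {μ : Measure (ι → ℂ)} [IsProbabilityMeasure μ] (hw : ∀ᵐ x ∂μ, ∑ i, ‖w x i‖ ^ 2 = 1) :
    HasLaw (fun q : (ι → ℂ) × (ι → ℂ) => ‖∑ i, q.2 i * w q.1 i‖ ^ 2) (gammaMeasure 1 1)
      (μ.prod (Measure.pi fun _ => complexGaussian)) := by
  refine hasLaw_prod_of_forall_ae_section (by fun_prop) ?_
  filter_upwards [hw] with x hx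
  exact hasLaw_sq_norm_complexGaussian.comp (hasLaw_sum_mul_pi hx)

lemma integrable_norm_sq_sum_mul_mul_sum_prod {w : (ι → ℂ) → ι → ℂ} (hwm : Measurable w)
    {μ : Measure (ι → ℂ)} [IsProbabilityMeasure μ] (hw : ∀ᵐ x ∂μ, ∑ i, ‖w x i‖ ^ 2 = 1) :
    Integrable (fun q : (ι → ℂ) × (ι → ℂ) => ‖∑ i, q.2 i * w q.1 i‖ ^ 2 * ∑ i, ‖q.2 i‖ ^ 2)
      (μ.prod (Measure.pi fun _ => complexGaussian)) := by
  classical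
  have hm : Measurable (fun q : (ι → ℂ) × (ι → ℂ) =>
    ‖∑ i, q.2 i * w q.1 i‖ ^ 2 * ∑ i, ‖q.2 i‖ ^ 2) := by fun_prop
  rw [integrable_prod_iff hm.aestronglyMeasurable]
  refine ⟨by filter_upwards [hw] with x hx using integrable_norm_sum_mul_sq_mul_sum hx, ?_⟩
  refine (integrable_const ((Fintype.card ι : ℝ) + 1)).congr ?_
  filter_upwards [hw] with x hx
  rw [← integral_norm_sum_mul_sq_mul_sum hx]
  exact integral_congr_ae (ae_of_all _ fun z => (Real.norm_of_nonneg (by positivity)).symm)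

lemma integral_norm_sq_sum_mul_mul_sum_prod {w : (ι → ℂ) → ι → ℂ} (hwm : Measurable w)
    {μ : Measure (ι → ℂ)} [IsProbabilityMeasure μ] (hw : ∀ᵐ x ∂μ, ∑ i, ‖w x i‖ ^ 2 = 1) :
    ∫ q : (ι → ℂ) × (ι → ℂ), ‖∑ i, q.2 i * w q.1 i‖ ^ 2 * ∑ i, ‖q.2 i‖ ^ 2
      ∂(μ.prod (Measure.pi fun _ => complexGaussian)) = Fintype.card ι + 1 := by
  classical
  rw [integral_prod _ (integrable_norm_sq_sum_mul_mul_sum_prod hwm hw),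
    integral_congr_ae (g := fun _ => (Fintype.card ι : ℝ) + 1)]
  · simp
  · filter_upwards [hw] with x hx using integral_norm_sum_mul_sq_mul_sum hx

end Product

/-! ### The beam and the resulting SNR -/

/-- The case `h = 0` is included, because `‖h‖ * ‖h‖ / ‖h‖ = ‖h‖` also holds at zero. -/
lemma tdot_mrtBeam_self {N : ℕ} (h : EuclideanSpace ℂ (Fin N)) :
    ‖tdot h (mrtBeam h)‖ ^ 2 = ‖h‖ ^ 2 := by
  have : tdot h (mrtBeam h) = ((‖h‖ ^ 2 / ‖h‖ : ℝ) : ℂ) := by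
    rw [EuclideanSpace.norm_sq_eq]
    simp only [tdot, mrtBeam]
    push_cast
    rw [Finset.sum_div]
    refine Finset.sum_congr rfl fun i _ => ?_
    rw [← mul_div_assoc, Complex.mul_conj, Complex.normSq_eq_norm_sq]
    push_cast
    rfl
  rw [this, Complex.norm_real, Real.norm_of_nonneg (by positivity), sq ‖h‖, mul_self_div_self]
  ring

lemma sum_norm_sq_mrtBeam {N : ℕ} {h : EuclideanSpace ℂ (Fin N)} (hh : h ≠ 0) :
    ∑ i, ‖mrtBeam h i‖ ^ 2 = 1 := by
  have h0 : ‖h‖ ^ 2 ≠ 0 := pow_ne_zero 2 (norm_ne_zero_iff.mpr hh)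
  have (i : Fin N) : ‖mrtBeam h i‖ ^ 2 = ‖h i‖ ^ 2 / ‖h‖ ^ 2 := by
    simp [mrtBeam, div_pow]
  simp_rw [this]
  rw [← Finset.sum_div, ← EuclideanSpace.norm_sq_eq, div_self h0]

/-- The constant in the relay numerator factors as `b₁c₁`. -/
lemma snr_mrtBeam {p : Params} (hp : p.Admissible) {N : ℕ} (h1 h2 : EuclideanSpace ℂ (Fin N))
    (h3 : ℂ) :
    snr p (mrtBeam h1) h1 h2 h3 = p.a1 * (‖h1‖ ^ 2) ^ 2 +
      p.b1 * (‖h1‖ ^ 2 * ‖h3‖ ^ 2) * (p.c1 * (‖tdot h2 (mrtBeam h1)‖ ^ 2 * ‖h2‖ ^ 2)) /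
        (p.b1 * (‖h1‖ ^ 2 * ‖h3‖ ^ 2) + p.c1 * (‖tdot h2 (mrtBeam h1)‖ ^ 2 * ‖h2‖ ^ 2) + 1) := by
  obtain ⟨_, _, ht, _, _, hd1, hd2, hd3⟩ := hp
  have ht' : 0 < 1 - p.tau := by linarith
  have e1 := Real.rpow_pos_of_pos hd1 p.alpha
  have e2 := Real.rpow_pos_of_pos hd2 (2 * p.alpha)
  have e3 := Real.rpow_pos_of_pos hd3 p.alpha
  rw [snr, tdot_mrtBeam_self, Params.a1, Params.b1, Params.c1]
  congr 1
  · ring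
  · congr 1
    · field_simp
      ring
    · ring

/-! ### Laws and independence of the link gains -/

section Rayleigh

variable {Ω : Type*} [MeasurableSpace Ω] {P : Measure Ω} {N : ℕ}
  {h1 h2 : Ω → EuclideanSpace ℂ (Fin N)} {h3 : Ω → ℂ}

lemma IsRayleigh.hasLaw_h1 (hR : IsRayleigh P h1 h2 h3) :
    HasLaw (fun ω i => h1 ω i) (Measure.pi fun _ : Fin N => complexGaussian) P :=
  (hR.indep.precomp Sum.inl_injective).hasLaw_pi hR.law_h1

lemma IsRayleigh.hasLaw_h2 (hR : IsRayleigh P h1 h2 h3) :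
    HasLaw (fun ω i => h2 ω i) (Measure.pi fun _ : Fin N => complexGaussian) P :=
  (hR.indep.precomp (g := Sum.inr ∘ Sum.inl)
    (Sum.inr_injective.comp Sum.inl_injective)).hasLaw_pi hR.law_h2

lemma IsRayleigh.aemeasurable (hR : IsRayleigh P h1 h2 h3) :
    ∀ j, AEMeasurable (Sum.elim (fun (i : Fin N) (ω : Ω) => h1 ω i)
      (Sum.elim (fun (i : Fin N) (ω : Ω) => h2 ω i) (fun (_ : Unit) (ω : Ω) => h3 ω)) j) P := by
  rintro (i | i | _)
  · exact (hR.law_h1 i).aemeasurable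
  · exact (hR.law_h2 i).aemeasurable
  · exact hR.law_h3.aemeasurable

lemma IsRayleigh.hasLaw_h1_h2 [IsProbabilityMeasure P] (hR : IsRayleigh P h1 h2 h3) :
    HasLaw (fun ω => ((fun i => h1 ω i : Fin N → ℂ), (fun i => h2 ω i : Fin N → ℂ)))
      ((Measure.pi fun _ => complexGaussian).prod (Measure.pi fun _ => complexGaussian)) P := by
  refine IndepFun.hasLaw_prod hR.hasLaw_h1 hR.hasLaw_h2 ?_
  have h := hR.indep.indepFun_finset₀ (Finset.univ.map ⟨Sum.inl, Sum.inl_injective⟩)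
    (Finset.univ.map ⟨Sum.inr ∘ Sum.inl, Sum.inr_injective.comp Sum.inl_injective⟩)
    (by rw [Finset.disjoint_left]; simp) hR.aemeasurable
  exact h.comp (φ := fun g (i : Fin N) => g ⟨Sum.inl i, by simp⟩)
    (ψ := fun g (i : Fin N) => g ⟨Sum.inr (Sum.inl i), by simp⟩)
    (measurable_pi_lambda _ fun _ => measurable_pi_apply _)
    (measurable_pi_lambda _ fun _ => measurable_pi_apply _)

lemma IsRayleigh.indepFun_h1_h3 (hR : IsRayleigh P h1 h2 h3) :
    IndepFun (fun ω i => h1 ω i) h3 P := by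
  have h := hR.indep.indepFun_finset₀ (Finset.univ.map ⟨Sum.inl, Sum.inl_injective⟩)
    {Sum.inr (Sum.inr ())} (by rw [Finset.disjoint_left]; simp) hR.aemeasurable
  exact h.comp (φ := fun g (i : Fin N) => g ⟨Sum.inl i, by simp⟩)
    (ψ := fun g => g ⟨Sum.inr (Sum.inr ()), by simp⟩)
    (measurable_pi_lambda _ fun _ => measurable_pi_apply _)
    (measurable_pi_apply (X := fun _ => ℂ) (⟨Sum.inr (Sum.inr ()), Finset.mem_singleton_self _⟩ :
      ({Sum.inr (Sum.inr ())} : Finset (Fin N ⊕ Fin N ⊕ Unit))))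

lemma hasLaw_norm_sq_of_pi (hN : 0 < N) {h : Ω → EuclideanSpace ℂ (Fin N)}
    (hh : HasLaw (fun ω i => h ω i) (Measure.pi fun _ : Fin N => complexGaussian) P) :
    HasLaw (fun ω => ‖h ω‖ ^ 2) (gammaMeasure N 1) P := by
  have : Nonempty (Fin N) := ⟨⟨0, hN⟩⟩
  have := hasLaw_sum_sq_norm_pi (ι := Fin N)
  rw [Fintype.card_fin] at this
  simp_rw [EuclideanSpace.norm_sq_eq]
  exact this.comp hh

/-- The beam has norm one off the origin, and the Gamma law of `‖h‖²` excludes the origin almost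
surely. -/
lemma mrtBeam_toLp_unit (hN : 0 < N) :
    ∀ᵐ x ∂(Measure.pi fun _ : Fin N => complexGaussian),
      ∑ i, ‖mrtBeam (WithLp.toLp 2 x) i‖ ^ 2 = 1 := by
  have h := ae_pos_of_hasLaw_gamma (hasLaw_norm_sq_of_pi (h := WithLp.toLp 2) hN HasLaw.id)
  filter_upwards [h] with x hx
  refine sum_norm_sq_mrtBeam fun h0 => ?_
  simp [h0] at hx

lemma measurable_mrtBeam_toLp :
    Measurable (fun (x : Fin N → ℂ) (i : Fin N) => mrtBeam (WithLp.toLp 2 x) i) := by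
  simp only [mrtBeam]
  have : Measurable fun x : Fin N → ℂ => ‖(WithLp.toLp 2 x : EuclideanSpace ℂ (Fin N))‖ := by
    fun_prop
  fun_prop

lemma IsRayleigh.hasLaw_relay_beam_gain [IsProbabilityMeasure P] (hN : 0 < N)
    (hR : IsRayleigh P h1 h2 h3) :
    HasLaw (fun ω => ‖tdot (h2 ω) (mrtBeam (h1 ω))‖ ^ 2) (gammaMeasure 1 1) P := by
  have h := hasLaw_norm_sq_sum_mul_prod (ι := Fin N) measurable_mrtBeam_toLp
    (mrtBeam_toLp_unit hN)
  have h' := h.comp hR.hasLaw_h1_h2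
  exact h'

lemma IsRayleigh.integrable_relay_gain [IsProbabilityMeasure P] (hN : 0 < N)
    (hR : IsRayleigh P h1 h2 h3) :
    Integrable (fun ω => ‖tdot (h2 ω) (mrtBeam (h1 ω))‖ ^ 2 * ‖h2 ω‖ ^ 2) P := by
  have h := integrable_norm_sq_sum_mul_mul_sum_prod (ι := Fin N) measurable_mrtBeam_toLp
    (mrtBeam_toLp_unit hN)
  simp_rw [EuclideanSpace.norm_sq_eq]
  exact (hR.hasLaw_h1_h2.integrable_comp_iff h.aestronglyMeasurable).mpr h

lemma IsRayleigh.integral_relay_gain [IsProbabilityMeasure P] (hN : 0 < N)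
    (hR : IsRayleigh P h1 h2 h3) :
    ∫ ω, ‖tdot (h2 ω) (mrtBeam (h1 ω))‖ ^ 2 * ‖h2 ω‖ ^ 2 ∂P = N + 1 := by
  have h := integrable_norm_sq_sum_mul_mul_sum_prod (ι := Fin N) measurable_mrtBeam_toLp
    (mrtBeam_toLp_unit hN)
  have h' := integral_norm_sq_sum_mul_mul_sum_prod (ι := Fin N) measurable_mrtBeam_toLp
    (mrtBeam_toLp_unit hN)
  rw [Fintype.card_fin, ← hR.hasLaw_h1_h2.integral_comp h.aestronglyMeasurable] at h'
  simp_rw [EuclideanSpace.norm_sq_eq]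
  exact h'

lemma IsRayleigh.hasLaw_sq_norm_h3 (hR : IsRayleigh P h1 h2 h3) :
    HasLaw (fun ω => ‖h3 ω‖ ^ 2) (gammaMeasure 1 1) P :=
  hasLaw_sq_norm_complexGaussian.comp hR.law_h3

lemma IsRayleigh.indepFun_sq_norm_h1_h3 (hR : IsRayleigh P h1 h2 h3) :
    IndepFun (fun ω => ‖h1 ω‖ ^ 2) (fun ω => ‖h3 ω‖ ^ 2) P := by
  simp_rw [EuclideanSpace.norm_sq_eq]
  exact hR.indepFun_h1_h3.comp (φ := fun x : Fin N → ℂ => ∑ i, ‖x i‖ ^ 2)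
    (ψ := fun z : ℂ => ‖z‖ ^ 2) (by fun_prop) (by fun_prop)

end Rayleigh

/-! ### Positivity, monotonicity in the fourth constant, and the theorem -/

lemma Params.Admissible.a1_pos {p : Params} (hp : p.Admissible) : 0 < p.a1 := by
  obtain ⟨_, _, ht, _, _, _, _, _⟩ := hp
  have : 0 < 1 - p.tau := by linarith
  unfold Params.a1 Params.rho
  positivity

lemma Params.Admissible.b1_pos {p : Params} (hp : p.Admissible) : 0 < p.b1 := by
  obtain ⟨_, _, ht, _, _, _, _, _⟩ := hp
  have : 0 < 1 - p.tau := by linarith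
  unfold Params.b1 Params.rho
  positivity

lemma Params.Admissible.c1_pos {p : Params} (hp : p.Admissible) : 0 < p.c1 := by
  obtain ⟨_, _, ht, _, _, _, _, _⟩ := hp
  have : 0 < 1 - p.tau := by linarith
  unfold Params.c1 Params.rho
  positivity

lemma lowerBound_anti {p : Params} (hp : p.Admissible) {N : ℕ} (hN : 2 ≤ N) {μ ν : ℝ}
    (hμ : 0 ≤ μ) (hμν : μ ≤ ν) : lowerBound p N ν ≤ lowerBound p N μ := by
  have hc := hp.c1_pos
  have h5 : 0 ≤ m5 p N := by rw [m5_eq p hN]; positivity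
  have ht : 0 ≤ (1 - p.tau) / 2 := by linarith [hp.tau_lt_one]
  have hlog : Real.log (1 + μ + m5 p N) ≤ Real.log (1 + ν + m5 p N) :=
    Real.log_le_log (by linarith) (by linarith)
  unfold lowerBound
  refine mul_le_mul_of_nonneg_left (Real.logb_le_logb_of_le (by norm_num) (by positivity) ?_) ht
  gcongr

lemma m4_le_m4' {p : Params} (hp : p.Admissible) {N : ℕ} (hN : 3 ≤ N) : m4 p N ≤ m4' p N := by
  have hb := hp.b1_pos
  have h : (3 : ℝ) ≤ N := by exact_mod_cast hN
  unfold m4 m4'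
  have : 0 ≤ p.b1 * N := by positivity
  nlinarith

end WirelessPowered

open WirelessPowered in
theorem theorem6 {Ω : Type*} [MeasurableSpace Ω] (P : Measure Ω) [IsProbabilityMeasure P]
    (p : WirelessPowered.Params) (hp : p.Admissible) (N : ℕ) (hN : 2 ≤ N)
    (h1 h2 : Ω → EuclideanSpace ℂ (Fin N)) (h3 : Ω → ℂ)
    (hR : WirelessPowered.IsRayleigh P h1 h2 h3) :
    Integrable (fun ω =>
        WirelessPowered.throughput p (WirelessPowered.mrtBeam (h1 ω)) (h1 ω) (h2 ω) (h3 ω)) P ∧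
      WirelessPowered.lowerBound p N (WirelessPowered.m4 p N) ≤
        ∫ ω, WirelessPowered.throughput p (WirelessPowered.mrtBeam (h1 ω)) (h1 ω) (h2 ω) (h3 ω) ∂P ∧
      (3 ≤ N → WirelessPowered.lowerBound p N (WirelessPowered.m4' p N) ≤
        ∫ ω, WirelessPowered.throughput p (WirelessPowered.mrtBeam (h1 ω)) (h1 ω) (h2 ω) (h3 ω)
          ∂P) := by
  have hN0 : 0 < N := by omega
  have hN' : (0 : ℝ) < N := by exact_mod_cast hN0
  have hX := hasLaw_norm_sq_of_pi hN0 hR.hasLaw_h1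
  have hY := hasLaw_norm_sq_of_pi hN0 hR.hasLaw_h2
  have hZ := hR.hasLaw_sq_norm_h3
  have hXi := integrable_of_hasLaw_gamma hN' hX
  have hZi := integrable_of_hasLaw_gamma one_pos hZ
  have hXZ' : ∫ ω, ‖h1 ω‖ ^ 2 * ‖h3 ω‖ ^ 2 ∂P = N := by
    rw [hR.indepFun_sq_norm_h1_h3.integral_fun_mul_eq_mul_integral hXi.aestronglyMeasurable
      hZi.aestronglyMeasurable, integral_of_hasLaw_gamma hN' hX,
      integral_of_hasLaw_gamma one_pos hZ, mul_one]
  obtain ⟨hint, hle⟩ := integrable_log_relay_and_le_integral hN0 hp.a1_pos hp.b1_pos hp.c1_pos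
    hX hY hZ (hR.hasLaw_relay_beam_gain hN0) (hR.indepFun_sq_norm_h1_h3.integrable_mul hXi hZi)
    hXZ' (hR.integrable_relay_gain hN0) (hR.integral_relay_gain hN0)
  simp_rw [← snr_mrtBeam hp] at hint hle
  have hthr : (fun ω => throughput p (mrtBeam (h1 ω)) (h1 ω) (h2 ω) (h3 ω)) =
      fun ω => (1 - p.tau) / 2 / Real.log 2 *
        Real.log (1 + snr p (mrtBeam (h1 ω)) (h1 ω) (h2 ω) (h3 ω)) := by
    funext ω
    rw [throughput, Real.logb]
    ring
  have hmain : lowerBound p N (m4 p N) ≤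
      ∫ ω, throughput p (mrtBeam (h1 ω)) (h1 ω) (h2 ω) (h3 ω) ∂P := by
    have hk : 0 ≤ (1 - p.tau) / 2 / Real.log 2 :=
      div_nonneg (by linarith [hp.tau_lt_one]) (Real.log_nonneg (by norm_num))
    rw [hthr, integral_const_mul]
    refine le_trans (le_of_eq ?_) (mul_le_mul_of_nonneg_left hle hk)
    -- The closed forms of `m3` and `m5` turn the stated exponents into those of the Jensen bound.
    rw [lowerBound, m3_eq p hN, m5_eq p hN, m1, m2, m4, Real.logb]
    ring
  refine ⟨?_, hmain, fun h => (lowerBound_anti hp hN ?_ (m4_le_m4' hp h)).trans hmain⟩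
  · rw [hthr]
    exact hint.const_mul _
  · exact mul_nonneg hp.b1_pos.le hN'.le
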